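/- Let $p\in[1,\infty)$ and write $\mathbb R_{>0}=(0,\infty)$, $\mathbb R_+=[0,\infty)$. Let $\mathcal M^p(\mathbb R_{>0})$ be the set of nonnegative Borel measures $\mu$ on $\mathbb R_{>0}$ that are finite on every compact subset of $\mathbb R_{>0}$ and satisfy $\int_{\mathbb R_{>0}} x^p\,d\mu(x)<\infty$ (the total mass near $0$ may be infinite). For $\mu,\nu\in\mathcal M^p(\mathbb R_{>0})$ let $\mathrm{Adm}(\mu,\nu)$ be the set of nonnegative Borel measures $\gamma$ on $\mathbb R_+\times\mathbb R_+$ that are finite on every compact subset of $(\mathbb R_+\times\mathbb R_+)\setminus\{(0,0)\}$ and satisfy $\gamma(A\times\mathbb R_+)=\mu(A)$ and $\gamma(\mathbb R_+\times B)=\nu(B)$ for all Borel sets $A,B\subset\mathbb R_{>0}$. Define the Figalli--Gigli distance by $$\mathrm{FG}_p(\mu,\nu)=\Big(\inf_{\gamma\in\mathrm{Adm}(\mu,\nu)}\iint_{\mathbb R_+\times\mathbb R_+}|x-y|^p\,d\gamma(x,y)\Big)^{1/p}.$$ For $x\in\mathbb R_+$ let $F_\mu(x)=\mu([x,\infty))$,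 and for $t>0$ let $F_\mu^{-1}(t)=\sup\{s\in\mathbb R_+ : F_\mu(s)\ge t\}$, with $F_\mu^{-1}(t)=0$ if this set is empty. Then for all $\mu,\nu\in\mathcal M^p(\mathbb R_{>0})$, $$\mathrm{FG}_p^p(\mu,\nu)=\int_0^\infty\big|F_\mu^{-1}(t)-F_\nu^{-1}(t)\big|^p\,dt .$$ -/

import Mathlib

open Set MeasureTheory
open scoped ENNReal

namespace FigalliGigli

section General

variable {X : Type*} [PseudoEMetricSpace X] [MeasurableSpace X]

/-- `μ` is a nonnegative Radon measure on `Ω`: it is carried by `Ω` and is finite on the compact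
subsets of `Ω` (it may have infinite total mass near the boundary of `Ω`). -/
structure IsRadonOn (Ω : Set X) (μ : Measure X) : Prop where
  compl_eq_zero : μ Ωᶜ = 0
  lt_top_of_isCompact : ∀ K : Set X, K ⊆ Ω → IsCompact K → μ K < ∞

/-- The `p`-persistence `(∫_Ω d(x, ∂Ω)^p dμ(x))^(1/p)`, an element of `[0, ∞]`. -/
noncomputable def pers (Ω : Set X) (p : ℝ) (μ : Measure X) : ℝ≥0∞ :=
  (∫⁻ x in Ω, Metric.infEDist x (frontier Ω) ^ p ∂μ) ^ (1 / p)

/-- Persistence measures: Radon measures on `Ω` with finite `p`-persistence. -/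
def IsPersistenceMeasure (Ω : Set X) (p : ℝ) (μ : Measure X) : Prop :=
  IsRadonOn Ω μ ∧ pers Ω p μ < ∞

/-- Admissible plans between `μ` and `ν`: measures carried by `Ω̄ × Ω̄`, finite on the compact
subsets of `(Ω̄ × Ω̄) \ (∂Ω × ∂Ω)`, whose marginals restricted to `Ω` are `μ` and `ν`. -/
structure IsAdmissible (Ω : Set X) (μ ν : Measure X) (γ : Measure (X × X)) : Prop where
  compl_eq_zero : γ (closure Ω ×ˢ closure Ω)ᶜ = 0
  lt_top_of_isCompact : ∀ K : Set (X × X),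
    K ⊆ (closure Ω ×ˢ closure Ω) \ (frontier Ω ×ˢ frontier Ω) → IsCompact K → γ K < ∞
  fst_eq : ∀ A : Set X, A ⊆ Ω → MeasurableSet A → γ (A ×ˢ closure Ω) = μ A
  snd_eq : ∀ B : Set X, B ⊆ Ω → MeasurableSet B → γ (closure Ω ×ˢ B) = ν B

/-- The Figalli--Gigli distance
`(inf_γ ∬_{Ω̄ × Ω̄} d(x, y)^p dγ(x, y))^(1/p)` over admissible plans `γ`, in `[0, ∞]`. -/
noncomputable def FG (Ω : Set X) (p : ℝ) (μ ν : Measure X) : ℝ≥0∞ :=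
  (⨅ (γ : Measure (X × X)) (_ : IsAdmissible Ω μ ν γ),
    ∫⁻ z in closure Ω ×ˢ closure Ω, edist z.1 z.2 ^ p ∂γ) ^ (1 / p)

end General

/-- The upper distribution function `F_μ(x) = μ([x, ∞))`. -/
noncomputable def upperDist (μ : Measure ℝ) (x : ℝ) : ℝ≥0∞ := μ (Ici x)

/-- The generalized inverse `F_μ⁻¹(x) = sup {t ≥ 0 : F_μ(t) ≥ x}` for `x > 0`; it is `0` if the
set is empty. For persistence measures on the half-line the set is bounded above for all `x > 0`,
see `bddAbove_upperQuantile`. -/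
noncomputable def upperQuantile (μ : Measure ℝ) (x : ℝ) : ℝ :=
  sSup {t : ℝ | 0 ≤ t ∧ ENNReal.ofReal x ≤ upperDist μ t}

/-- The supremum defining `upperQuantile` is one of a bounded set, in the case of interest. -/
theorem bddAbove_upperQuantile {p : ℝ} (hp : 1 ≤ p) {μ : Measure ℝ}
    (hμ : IsPersistenceMeasure (Ioi (0 : ℝ)) p μ) {x : ℝ} (hx : 0 < x) :
    BddAbove {t : ℝ | 0 ≤ t ∧ ENNReal.ofReal x ≤ upperDist μ t} := by
  have hp0 : 0 < p := by linarith
  obtain ⟨-, hfin⟩ := hμ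
  unfold pers at hfin
  rw [frontier_Ioi] at hfin
  set I : ℝ≥0∞ := ∫⁻ y in Ioi (0 : ℝ), Metric.infEDist y {(0 : ℝ)} ^ p ∂μ with hI
  have hIfin : I ≠ ∞ := by
    intro h
    rw [h, ENNReal.top_rpow_of_pos (by positivity)] at hfin
    exact lt_irrefl _ hfin
  have hx' : ENNReal.ofReal x ≠ 0 := by simpa using hx
  refine ⟨max 1 (I / ENNReal.ofReal x).toReal, ?_⟩
  rintro t ⟨-, ht⟩
  by_contra! hlt
  have h1 : 1 < t := lt_of_le_of_lt (le_max_left _ _) hlt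
  have h2 : (I / ENNReal.ofReal x).toReal < t := lt_of_le_of_lt (le_max_right _ _) hlt
  have hmark : ENNReal.ofReal t * μ (Ici t) ≤ I := by
    calc ENNReal.ofReal t * μ (Ici t)
        = ∫⁻ _ in Ici t, ENNReal.ofReal t ∂μ := by simp
      _ ≤ ∫⁻ y in Ici t, Metric.infEDist y {(0 : ℝ)} ^ p ∂μ := by
          refine setLIntegral_mono' measurableSet_Ici fun y hy => ?_
          have hy : t ≤ y := hy
          rw [Metric.infEDist_singleton, edist_dist, Real.dist_eq, sub_zero,
            abs_of_pos (by linarith), ENNReal.ofReal_rpow_of_pos (by linarith)]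
          refine ENNReal.ofReal_le_ofReal (hy.trans ?_)
          simpa using Real.rpow_le_rpow_of_exponent_le (by linarith : 1 ≤ y) hp
      _ ≤ I := lintegral_mono_set fun y hy => by
          have hy : t ≤ y := hy
          exact lt_of_lt_of_le (by linarith) hy
  have hle : ENNReal.ofReal t ≤ I / ENNReal.ofReal x := by
    rw [ENNReal.le_div_iff_mul_le (Or.inl hx') (Or.inl ENNReal.ofReal_ne_top)]
    exact (mul_le_mul_right ht _).trans hmark
  have := (ENNReal.ofReal_le_iff_le_toReal (ENNReal.div_ne_top hIfin hx')).1 hle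
  linarith

end FigalliGigli

/-! For `≤`, push Lebesgue measure on `(0, ∞)` forward by the pair of generalized inverses: this
plan is admissible (`isAdmissible_quantilePlan`) and its cost is the right-hand side. For `≥`, split
`|x - y|^p = (x - y)₊^p + (y - x)₊^p`. By the layer-cake formula `(x - y)₊^p` is an integral over
`t, r > 0` of indicators of `{y < t, x ∈ U}`, with `U ⊆ (0, ∞)` an upper set depending on `(t, r)`.
Every admissible plan gives such a layer mass at least `μ U - ν [t, ∞)`. The monotone plan gives
exactly its positive part, since superlevel sets of the two inverses are nested
(`IsAdmissible.volume_upperQuantile_le`). Integrating over the layers by Tonelli bounds one half of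
the cost; swapping coordinates bounds the other. -/

namespace FigalliGigli

/-! ### Generalized inverses and their pushforward of Lebesgue measure -/

section Quantile

variable {p : ℝ} {μ ν : Measure ℝ}

/-- Markov's inequality for `y ^ p`. -/
theorem IsPersistenceMeasure.measure_Ici_lt_top (hp : 1 ≤ p)
    (hμ : IsPersistenceMeasure (Ioi (0 : ℝ)) p μ) {s : ℝ} (hs : 0 < s) : μ (Ici s) < ∞ := by
  have hp0 : 0 < p := by linarith
  obtain ⟨-, hfin⟩ := hμ
  unfold pers at hfin
  rw [frontier_Ioi] at hfin
  set I : ℝ≥0∞ := ∫⁻ y in Ioi (0 : ℝ), Metric.infEDist y {(0 : ℝ)} ^ p ∂μ with hI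
  have hIfin : I < ∞ := by
    by_contra h
    rw [not_lt_top_iff.1 h, ENNReal.top_rpow_of_pos (by positivity)] at hfin
    exact lt_irrefl _ hfin
  have hmark : ENNReal.ofReal s ^ p * μ (Ici s) ≤ I := by
    calc ENNReal.ofReal s ^ p * μ (Ici s)
        = ∫⁻ _ in Ici s, ENNReal.ofReal s ^ p ∂μ := by simp
      _ ≤ ∫⁻ y in Ici s, Metric.infEDist y {(0 : ℝ)} ^ p ∂μ := by
          refine setLIntegral_mono' measurableSet_Ici fun y hy => ?_
          have hy : s ≤ y := hy
          rw [Metric.infEDist_singleton, edist_dist, Real.dist_eq, sub_zero,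
            abs_of_pos (by linarith)]
          gcongr
      _ ≤ I := lintegral_mono_set fun y hy => lt_of_lt_of_le hs hy
  refine ENNReal.lt_top_of_mul_ne_top_right (hmark.trans_lt hIfin).ne ?_
  exact (ENNReal.rpow_pos (by simpa using hs) ENNReal.ofReal_ne_top).ne'

theorem upperQuantile_nonneg (μ : Measure ℝ) (t : ℝ) : 0 ≤ upperQuantile μ t :=
  Real.sSup_nonneg fun _ h => h.1

theorem upperQuantile_of_nonpos (μ : Measure ℝ) {t : ℝ} (ht : t ≤ 0) : upperQuantile μ t = 0 := by
  have : {s : ℝ | 0 ≤ s ∧ ENNReal.ofReal t ≤ upperDist μ s} = Ici 0 := by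
    ext s; simp [ENNReal.ofReal_of_nonpos ht]
  rw [upperQuantile, this]
  -- The true supremum is infinite; `0` is the default value of `sSup`.
  exact Real.sSup_of_not_bddAbove (not_bddAbove_Ici 0)

/-- The Galois connection between `F_μ` and its generalized inverse. -/
theorem le_upperQuantile_iff (hp : 1 ≤ p) (hμ : IsPersistenceMeasure (Ioi (0 : ℝ)) p μ)
    {s t : ℝ} (hs : 0 < s) (ht : 0 < t) :
    s ≤ upperQuantile μ t ↔ ENNReal.ofReal t ≤ μ (Ici s) := by
  refine ⟨fun h => ?_, fun h => le_csSup (bddAbove_upperQuantile hp hμ ht) ⟨hs.le, h⟩⟩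
  have hlow : ∀ r < s, ENNReal.ofReal t ≤ μ (Ici r) := by
    intro r hr
    have hne : {u : ℝ | 0 ≤ u ∧ ENNReal.ofReal t ≤ upperDist μ u}.Nonempty := by
      by_contra hemp
      rw [upperQuantile, not_nonempty_iff_eq_empty.1 hemp, Real.sSup_empty] at h
      linarith
    obtain ⟨u, hu, hru⟩ := exists_lt_of_lt_csSup hne (hr.trans_le h)
    exact hu.2.trans (measure_mono (Ici_subset_Ici.2 hru.le))
  obtain ⟨u, hu, hmem, hlim⟩ := exists_seq_strictMono_tendsto' hs
  have hInter : ⋂ n, Ici (u n) = Ici s := by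
    ext x
    simp only [mem_iInter, mem_Ici]
    exact ⟨fun hx => le_of_tendsto' hlim hx, fun hx n => (hmem n).2.le.trans hx⟩
  -- Continuity from above; finiteness holds because `u 0 > 0`.
  rw [← hInter, Antitone.measure_iInter (fun m n hmn => Ici_subset_Ici.2 (hu.monotone hmn))
    (fun n => measurableSet_Ici.nullMeasurableSet)
    ⟨0, (hμ.measure_Ici_lt_top hp (hmem 0).1).ne⟩]
  exact le_iInf fun n => hlow _ (hmem n).2

theorem antitoneOn_upperQuantile (hp : 1 ≤ p) (hμ : IsPersistenceMeasure (Ioi (0 : ℝ)) p μ) :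
    AntitoneOn (upperQuantile μ) (Ioi 0) := by
  intro a ha b hb hab
  rcases (upperQuantile_nonneg μ b).eq_or_lt with h | h
  · rw [← h]; exact upperQuantile_nonneg μ a
  · rw [le_upperQuantile_iff hp hμ h ha]
    exact (ENNReal.ofReal_le_ofReal hab).trans ((le_upperQuantile_iff hp hμ h hb).1 le_rfl)

theorem measurable_upperQuantile (hp : 1 ≤ p) (hμ : IsPersistenceMeasure (Ioi (0 : ℝ)) p μ) :
    Measurable (upperQuantile μ) := by
  refine measurable_of_Ici fun s => ?_
  rcases le_or_gt s 0 with hs | hs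
  · convert MeasurableSet.univ
    exact eq_univ_of_forall fun t => hs.trans (upperQuantile_nonneg μ t)
  · have : upperQuantile μ ⁻¹' Ici s = Ioi 0 ∩ {t | ENNReal.ofReal t ≤ μ (Ici s)} := by
      ext t
      rcases le_or_gt t 0 with ht | ht
      · simp [upperQuantile_of_nonpos μ ht, ht.not_gt, hs.not_ge]
      · simp [le_upperQuantile_iff hp hμ hs ht, ht]
    rw [this]
    exact measurableSet_Ioi.inter (measurableSet_le ENNReal.measurable_ofReal measurable_const)

theorem volume_le_upperQuantile (hp : 1 ≤ p) (hμ : IsPersistenceMeasure (Ioi (0 : ℝ)) p μ)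
    {s : ℝ} (hs : 0 < s) :
    volume.restrict (Ioi 0) (upperQuantile μ ⁻¹' Ici s) = μ (Ici s) := by
  rw [Measure.restrict_apply (measurable_upperQuantile hp hμ measurableSet_Ici)]
  have : upperQuantile μ ⁻¹' Ici s ∩ Ioi 0 = Ioc 0 (μ (Ici s)).toReal := by
    ext t
    simp only [mem_inter_iff, mem_preimage, mem_Ici, mem_Ioi, mem_Ioc]
    rw [and_comm]
    refine and_congr_right fun ht => ?_
    rw [le_upperQuantile_iff hp hμ hs ht,
      ENNReal.ofReal_le_iff_le_toReal (hμ.measure_Ici_lt_top hp hs).ne]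
  rw [this, Real.volume_Ioc, sub_zero, ENNReal.ofReal_toReal (hμ.measure_Ici_lt_top hp hs).ne]

/-- On `(0, ∞)`, the generalized inverse pushes the Lebesgue measure forward to `μ`. -/
theorem volume_preimage_upperQuantile (hp : 1 ≤ p)
    (hμ : IsPersistenceMeasure (Ioi (0 : ℝ)) p μ) {A : Set ℝ} (hA : A ⊆ Ioi 0)
    (hAm : MeasurableSet A) :
    volume.restrict (Ioi 0) (upperQuantile μ ⁻¹' A) = μ A := by
  set m := (volume.restrict (Ioi (0 : ℝ))).map (upperQuantile μ) with hm
  have hmeas := measurable_upperQuantile hp hμ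
  have hIci : ∀ s > 0, m (Ici s) = μ (Ici s) := fun s hs => by
    rw [hm, Measure.map_apply hmeas measurableSet_Ici, volume_le_upperQuantile hp hμ hs]
  -- Both measures may be infinite near `0`; away from it they are finite, hence determined by
  -- half-lines.
  have hres : ∀ n : ℕ, m.restrict (Ici (1 / ((n : ℝ) + 1))) =
      μ.restrict (Ici (1 / ((n : ℝ) + 1))) := by
    intro n
    have hn : (0 : ℝ) < 1 / ((n : ℝ) + 1) := by positivity
    have : IsFiniteMeasure (m.restrict (Ici (1 / ((n : ℝ) + 1)))) :=
      ⟨by rw [Measure.restrict_apply_univ, hIci _ hn]; exact hμ.measure_Ici_lt_top hp hn⟩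
    refine Measure.ext_of_Ici _ _ fun a => ?_
    rw [Measure.restrict_apply measurableSet_Ici, Measure.restrict_apply measurableSet_Ici,
      Ici_inter_Ici]
    exact hIci _ (lt_sup_of_lt_right hn)
  have hU : ⋃ n : ℕ, Ici (1 / ((n : ℝ) + 1)) = Ioi 0 := by
    ext x
    simp only [mem_iUnion, mem_Ici, mem_Ioi]
    refine ⟨fun ⟨n, hn⟩ => lt_of_lt_of_le (by positivity) hn, fun hx => ?_⟩
    obtain ⟨n, hn⟩ := exists_nat_one_div_lt hx
    exact ⟨n, hn.le⟩
  have key := Measure.restrict_iUnion_congr.2 hres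
  rw [hU] at key
  have := congrArg (fun ρ => ρ A) key
  simp only [Measure.restrict_apply hAm, inter_eq_left.2 hA] at this
  rw [← this, hm, Measure.map_apply hmeas hAm]

end Quantile

/-! ### Layer-cake decomposition of the cost -/

section LayerCake

variable {p : ℝ}

theorem setLIntegral_Ioc_rpow_sub (hp : 1 ≤ p) {x y : ℝ} (hxy : y ≤ x) :
    ∫⁻ t in Ioc y x, ENNReal.ofReal (p * (x - t) ^ (p - 1)) = ENNReal.ofReal ((x - y) ^ p) := by
  have hint : IntervalIntegrable (fun t : ℝ => p * (x - t) ^ (p - 1)) volume y x := by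
    refine Continuous.intervalIntegrable ?_ _ _
    exact continuous_const.mul ((continuous_const.sub continuous_id).rpow_const
      fun t => Or.inr (by linarith))
  rw [← ofReal_integral_eq_lintegral_ofReal
      ((intervalIntegrable_iff_integrableOn_Ioc_of_le hxy).1 hint)]
  · rw [← intervalIntegral.integral_of_le hxy, intervalIntegral.integral_const_mul,
      intervalIntegral.integral_comp_sub_left (fun u => u ^ (p - 1)) x,
      integral_rpow (Or.inl (by linarith))]
    have hp0 : p ≠ 0 := by linarith
    simp [hp0]
    field_simp
  · filter_upwards [ae_restrict_mem measurableSet_Ioc] with t ht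
    exact mul_nonneg (by linarith) (Real.rpow_nonneg (by linarith [ht.2]) _)

/-- The cost `(x - y)₊ ^ p` as a superposition of indicators of products of an upper set in `x` with
a lower set in `y`. -/
theorem lintegral_indicator_eq_posPart_rpow (hp : 1 ≤ p) {x y : ℝ} (hy : 0 ≤ y) :
    ((volume.restrict (Ioi (0 : ℝ))).prod (volume.restrict (Ioi (0 : ℝ))))
      {q | y < q.1 ∧ q.1 ≤ x ∧ q.2 ≤ p * (x - q.1) ^ (p - 1)} =
      ENNReal.ofReal (max (x - y) 0 ^ p) := by
  have hms : MeasurableSet {q : ℝ × ℝ | y < q.1 ∧ q.1 ≤ x ∧ q.2 ≤ p * (x - q.1) ^ (p - 1)} := by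
    refine (measurableSet_lt measurable_const measurable_fst).inter
      ((measurableSet_le measurable_fst measurable_const).inter
        (measurableSet_le measurable_snd (by fun_prop)))
  rw [Measure.prod_apply hms]
  have hslice : ∀ t : ℝ, volume.restrict (Ioi (0 : ℝ))
      (Prod.mk t ⁻¹' {q : ℝ × ℝ | y < q.1 ∧ q.1 ≤ x ∧ q.2 ≤ p * (x - q.1) ^ (p - 1)}) =
      (Ioc y x).indicator (fun t => ENNReal.ofReal (p * (x - t) ^ (p - 1))) t := by
    intro t
    rw [Measure.restrict_apply (measurable_prodMk_left hms)]
    by_cases ht : t ∈ Ioc y x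
    · rw [indicator_of_mem ht]
      have : Prod.mk t ⁻¹' {q : ℝ × ℝ | y < q.1 ∧ q.1 ≤ x ∧ q.2 ≤ p * (x - q.1) ^ (p - 1)} ∩ Ioi 0
          = Ioc 0 (p * (x - t) ^ (p - 1)) := by
        ext r
        simp [ht.1, ht.2, and_comm]
      rw [this, Real.volume_Ioc, sub_zero]
    · rw [indicator_of_notMem ht]
      convert measure_empty (μ := (volume : Measure ℝ))
      ext r
      simp only [mem_inter_iff, mem_preimage, mem_ofPred_eq, mem_empty_iff_false, iff_false]
      exact fun h => ht ⟨h.1.1, h.1.2.1⟩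
  simp_rw [hslice]
  rw [lintegral_indicator measurableSet_Ioc, Measure.restrict_restrict measurableSet_Ioc,
    inter_eq_left.2 (show Ioc y x ⊆ Ioi 0 from fun t ht => lt_of_le_of_lt hy ht.1)]
  rcases le_total y x with h | h
  · rw [setLIntegral_Ioc_rpow_sub hp h, max_eq_left (by linarith)]
  · rw [Ioc_eq_empty (by linarith), max_eq_right (by linarith),
      Real.zero_rpow (by linarith)]
    simp

/-- Tonelli applied to the pointwise layer-cake formula; this is where `SFinite` enters. -/
theorem lintegral_posPart_rpow_eq {α : Type*} [MeasurableSpace α] (hp : 1 ≤ p)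
    (ρ : Measure α) [SFinite ρ] {f g : α → ℝ} (hf : Measurable f) (hg : Measurable g)
    (hg0 : ∀ᵐ a ∂ρ, 0 ≤ g a) :
    ∫⁻ a, ENNReal.ofReal (max (f a - g a) 0 ^ p) ∂ρ =
      ∫⁻ q, ρ {a | g a < q.1 ∧ q.1 ≤ f a ∧ q.2 ≤ p * (f a - q.1) ^ (p - 1)}
        ∂((volume.restrict (Ioi (0 : ℝ))).prod (volume.restrict (Ioi (0 : ℝ)))) := by
  set m := (volume.restrict (Ioi (0 : ℝ))).prod (volume.restrict (Ioi (0 : ℝ)))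
  let W : Set (α × (ℝ × ℝ)) :=
    {w | g w.1 < w.2.1 ∧ w.2.1 ≤ f w.1 ∧ w.2.2 ≤ p * (f w.1 - w.2.1) ^ (p - 1)}
  have hW : MeasurableSet W := by
    have hf' : Measurable fun w : α × (ℝ × ℝ) => f w.1 := hf.comp measurable_fst
    have ht : Measurable fun w : α × (ℝ × ℝ) => w.2.1 := by fun_prop
    exact (measurableSet_lt (hg.comp measurable_fst) ht).inter
      ((measurableSet_le ht hf').inter (measurableSet_le measurable_snd.snd
        (((hf'.sub ht).pow_const _).const_mul _)))
  calc ∫⁻ a, ENNReal.ofReal (max (f a - g a) 0 ^ p) ∂ρ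
      = ∫⁻ a, m (Prod.mk a ⁻¹' W) ∂ρ := by
        refine lintegral_congr_ae ?_
        filter_upwards [hg0] with a ha
        exact (lintegral_indicator_eq_posPart_rpow hp ha).symm
    _ = (ρ.prod m) W := (Measure.prod_apply hW).symm
    _ = _ := Measure.prod_apply_symm hW

end LayerCake

/-! ### Admissible plans and optimality of the monotone one -/

section Plans

variable {p : ℝ} {μ ν : Measure ℝ} {γ : Measure (ℝ × ℝ)}

/-- The monotone rearrangement plan: the law of the pair of generalized inverses under the Lebesgue
measure of `(0, ∞)`. -/
noncomputable def quantilePlan (μ ν : Measure ℝ) : Measure (ℝ × ℝ) :=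
  (volume.restrict (Ioi (0 : ℝ))).map fun t => (upperQuantile μ t, upperQuantile ν t)

/-- `max z.1 z.2` attains a positive minimum on a nonempty `K`. -/
theorem exists_Ici_cover_of_isCompact {K : Set (ℝ × ℝ)}
    (hK : K ⊆ (Ici 0 ×ˢ Ici 0) \ {((0 : ℝ), (0 : ℝ))}) (hKc : IsCompact K) :
    ∃ ε > 0, K ⊆ (Prod.fst ⁻¹' Ici ε) ∪ (Prod.snd ⁻¹' Ici ε) := by
  rcases K.eq_empty_or_nonempty with rfl | hne
  · exact ⟨1, one_pos, empty_subset _⟩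
  obtain ⟨z, hz, hmin⟩ := hKc.exists_isMinOn hne
    (f := fun z : ℝ × ℝ => max z.1 z.2) (by fun_prop)
  refine ⟨max z.1 z.2, ?_, fun w hw => ?_⟩
  · obtain ⟨⟨h1, h2⟩, h3⟩ := hK hz
    by_contra! h
    exact h3 (Prod.ext (le_antisymm ((le_max_left _ _).trans h) h1)
      (le_antisymm ((le_max_right _ _).trans h) h2))
  · exact le_max_iff.1 (isMinOn_iff.1 hmin w hw)

/-- Times at which both inverses vanish go to the corner, whose mass is unconstrained. -/
theorem isAdmissible_quantilePlan (hp : 1 ≤ p) (hμ : IsPersistenceMeasure (Ioi (0 : ℝ)) p μ)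
    (hν : IsPersistenceMeasure (Ioi (0 : ℝ)) p ν) :
    IsAdmissible (Ioi (0 : ℝ)) μ ν (quantilePlan μ ν) := by
  have hmμ := measurable_upperQuantile hp hμ
  have hmν := measurable_upperQuantile hp hν
  have hm := hmμ.prodMk hmν
  constructor
  · rw [closure_Ioi, quantilePlan,
      Measure.map_apply hm (measurableSet_Ici.prod measurableSet_Ici).compl]
    convert measure_empty (μ := volume.restrict (Ioi (0 : ℝ)))
    ext t
    simp [upperQuantile_nonneg]
  · intro K hK hKc
    rw [closure_Ioi, frontier_Ioi, singleton_prod_singleton] at hK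
    obtain ⟨ε, hε, hcov⟩ := exists_Ici_cover_of_isCompact hK hKc
    refine (measure_mono hcov).trans_lt ((measure_union_le _ _).trans_lt ?_)
    rw [quantilePlan, Measure.map_apply hm (measurable_fst measurableSet_Ici),
      Measure.map_apply hm (measurable_snd measurableSet_Ici)]
    exact ENNReal.add_lt_top.2
      ⟨(volume_le_upperQuantile hp hμ hε).trans_lt (hμ.measure_Ici_lt_top hp hε),
        (volume_le_upperQuantile hp hν hε).trans_lt (hν.measure_Ici_lt_top hp hε)⟩
  · intro A hA hAm
    rw [closure_Ioi, quantilePlan, Measure.map_apply hm (hAm.prod measurableSet_Ici),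
      ← volume_preimage_upperQuantile hp hμ hA hAm]
    congr 1
    ext t
    simp [upperQuantile_nonneg]
  · intro B hB hBm
    rw [closure_Ioi, quantilePlan, Measure.map_apply hm (measurableSet_Ici.prod hBm),
      ← volume_preimage_upperQuantile hp hν hB hBm]
    congr 1
    ext t
    simp [upperQuantile_nonneg]

theorem IsAdmissible.swap (hγ : IsAdmissible (Ioi (0 : ℝ)) μ ν γ) :
    IsAdmissible (Ioi (0 : ℝ)) ν μ (γ.map Prod.swap) := by
  have happ : ∀ S : Set (ℝ × ℝ), γ.map Prod.swap S = γ (Prod.swap ⁻¹' S) := fun S =>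
    MeasurableEquiv.prodComm.map_apply S
  constructor
  · rw [happ, preimage_compl, preimage_swap_prod]
    exact hγ.compl_eq_zero
  · intro K hK hKc
    rw [happ, ← image_swap_eq_preimage_swap]
    refine hγ.lt_top_of_isCompact _ ?_ (hKc.image continuous_swap)
    rintro _ ⟨z, hz, rfl⟩
    obtain ⟨⟨h1, h2⟩, h3⟩ := hK hz
    exact ⟨⟨h2, h1⟩, fun h => h3 ⟨h.2, h.1⟩⟩
  · intro A hA hAm
    rw [happ, preimage_swap_prod]
    exact hγ.snd_eq A hA hAm
  · intro B hB hBm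
    rw [happ, preimage_swap_prod]
    exact hγ.fst_eq B hB hBm

theorem IsAdmissible.ae_nonneg (hγ : IsAdmissible (Ioi (0 : ℝ)) μ ν γ) :
    ∀ᵐ z ∂γ, 0 ≤ z.1 ∧ 0 ≤ z.2 := by
  have h := hγ.compl_eq_zero
  rw [closure_Ioi] at h
  exact h

theorem IsAdmissible.measure_fst_preimage (hγ : IsAdmissible (Ioi (0 : ℝ)) μ ν γ) {A : Set ℝ}
    (hA : A ⊆ Ioi 0) (hAm : MeasurableSet A) : γ (Prod.fst ⁻¹' A) = μ A := by
  rw [← hγ.fst_eq A hA hAm, closure_Ioi]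
  refine measure_congr ?_
  filter_upwards [hγ.ae_nonneg] with z hz
  exact propext ⟨fun h => ⟨h, hz.2⟩, fun h => h.1⟩

theorem IsAdmissible.measure_snd_preimage (hγ : IsAdmissible (Ioi (0 : ℝ)) μ ν γ) {B : Set ℝ}
    (hB : B ⊆ Ioi 0) (hBm : MeasurableSet B) : γ (Prod.snd ⁻¹' B) = ν B := by
  rw [← hγ.snd_eq B hB hBm, closure_Ioi]
  refine measure_congr ?_
  filter_upwards [hγ.ae_nonneg] with z hz
  exact propext ⟨fun h => ⟨hz.1, h⟩, fun h => h.2⟩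

/-- Away from the corner, an admissible plan is `σ`-finite. -/
theorem IsAdmissible.sFinite_restrict (hp : 1 ≤ p)
    (hμ : IsPersistenceMeasure (Ioi (0 : ℝ)) p μ) (hν : IsPersistenceMeasure (Ioi (0 : ℝ)) p ν)
    (hγ : IsAdmissible (Ioi (0 : ℝ)) μ ν γ) :
    SFinite (γ.restrict {z : ℝ × ℝ | 0 < z.1 ∨ 0 < z.2}) := by
  let D : Set (ℝ × ℝ) := {z | 0 < z.1 ∨ 0 < z.2}
  -- `Dᶜ` is null for the restricted measure; it is added so that the sets cover the plane.
  let E : ℕ → Set (ℝ × ℝ) := fun n =>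
    (Prod.fst ⁻¹' Ici (1 / ((n : ℝ) + 1)) ∪ Prod.snd ⁻¹' Ici (1 / ((n : ℝ) + 1))) ∪ Dᶜ
  have hDm : MeasurableSet D :=
    (measurableSet_lt measurable_const measurable_fst).union
      (measurableSet_lt measurable_const measurable_snd)
  have hfin : ∀ n, γ.restrict D (E n) < ∞ := by
    intro n
    have hn : (0 : ℝ) < 1 / ((n : ℝ) + 1) := by positivity
    have hsub : Ici (1 / ((n : ℝ) + 1)) ⊆ Ioi 0 := fun x hx => lt_of_lt_of_le hn hx
    refine (measure_union_le _ _).trans_lt ?_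
    rw [Measure.restrict_apply hDm.compl, compl_inter_self, measure_empty, add_zero]
    refine (Measure.restrict_apply_le _ _).trans_lt ((measure_union_le _ _).trans_lt ?_)
    rw [hγ.measure_fst_preimage hsub measurableSet_Ici,
      hγ.measure_snd_preimage hsub measurableSet_Ici]
    exact ENNReal.add_lt_top.2 ⟨hμ.measure_Ici_lt_top hp hn, hν.measure_Ici_lt_top hp hn⟩
  have hspan : ⋃ n, E n = univ := by
    refine eq_univ_of_forall fun z => mem_iUnion.2 ?_
    by_cases hz : z ∈ D
    · rcases hz with h | h
      · obtain ⟨n, hn⟩ := exists_nat_one_div_lt h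
        exact ⟨n, Or.inl (Or.inl hn.le)⟩
      · obtain ⟨n, hn⟩ := exists_nat_one_div_lt h
        exact ⟨n, Or.inl (Or.inr hn.le)⟩
    · exact ⟨0, Or.inr hz⟩
  have : SigmaFinite (γ.restrict D) := ⟨⟨⟨E, fun _ => trivial, hfin, hspan⟩⟩⟩
  change SFinite (γ.restrict D)
  infer_instance

/-- Every admissible plan charges the product of an upper set and a lower set at least as much as
the monotone rearrangement does. -/
theorem IsAdmissible.volume_upperQuantile_le (hp : 1 ≤ p)
    (hμ : IsPersistenceMeasure (Ioi (0 : ℝ)) p μ) (hν : IsPersistenceMeasure (Ioi (0 : ℝ)) p ν)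
    (hγ : IsAdmissible (Ioi (0 : ℝ)) μ ν γ) {U : Set ℝ} (hU : IsUpperSet U) (hU0 : U ⊆ Ioi 0)
    {t : ℝ} (ht : 0 < t) :
    volume.restrict (Ioi 0) {τ | upperQuantile ν τ < t ∧ upperQuantile μ τ ∈ U} ≤
      γ {z | z.2 < t ∧ z.1 ∈ U} := by
  have hUm : MeasurableSet U := hU.ordConnected.measurableSet
  have hmμ := measurable_upperQuantile hp hμ
  have hmν := measurable_upperQuantile hp hν
  set m := volume.restrict (Ioi (0 : ℝ))
  set A := upperQuantile μ ⁻¹' U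
  set B := upperQuantile ν ⁻¹' Ici t
  have hAB : {τ | upperQuantile ν τ < t ∧ upperQuantile μ τ ∈ U} = A \ B := by
    ext τ
    simp [A, B, and_comm]
  have hsubt : Ici t ⊆ Ioi 0 := fun x hx => lt_of_lt_of_le ht hx
  have hmB : m B = ν (Ici t) := volume_preimage_upperQuantile hp hν hsubt measurableSet_Ici
  have hmA : m A = μ U := volume_preimage_upperQuantile hp hμ hU0 hUm
  have hpos : ∀ a ∈ A, 0 < a := fun a ha => by
    by_contra! h
    have h0 : upperQuantile μ a ∈ U := ha
    rw [upperQuantile_of_nonpos μ h] at h0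
    exact lt_irrefl (0 : ℝ) (hU0 h0)
  rw [hAB]
  -- By monotonicity of the inverses, `A` and `B` are initial segments of `(0, ∞)`, so one contains
  -- the other.
  by_cases hsub : A ⊆ B
  · simp [sdiff_eq_empty.2 hsub]
  · obtain ⟨a, haA, haB⟩ := not_subset.1 hsub
    have hBA : m (A \ B) = m A - m B := by
      refine measure_sdiff ?_ (hmν measurableSet_Ici).nullMeasurableSet
        (by rw [hmB]; exact (hν.measure_Ici_lt_top hp ht).ne)
      intro b hb
      have hb0 : 0 < b := by
        by_contra! h
        have h0 : t ≤ upperQuantile ν b := hb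
        rw [upperQuantile_of_nonpos ν h] at h0
        exact ht.not_ge h0
      have hba : b ≤ a := by
        by_contra! h
        exact haB (le_trans (show t ≤ upperQuantile ν b from hb)
          (antitoneOn_upperQuantile hp hν (hpos a haA) hb0 h.le))
      exact hU (antitoneOn_upperQuantile hp hμ hb0 (hpos a haA) hba) haA
    rw [hBA, hmA, hmB, tsub_le_iff_right, ← hγ.measure_fst_preimage hU0 hUm,
      ← hγ.measure_snd_preimage hsubt measurableSet_Ici]
    -- `{x ∈ U} ⊆ {y < t, x ∈ U} ∪ {y ≥ t}`.
    refine (measure_mono fun z hz => ?_).trans (measure_union_le _ _)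
    rcases lt_or_ge z.2 t with h | h
    · exact Or.inl ⟨h, hz⟩
    · exact Or.inr h

theorem IsAdmissible.lintegral_posPart_le (hp : 1 ≤ p)
    (hμ : IsPersistenceMeasure (Ioi (0 : ℝ)) p μ) (hν : IsPersistenceMeasure (Ioi (0 : ℝ)) p ν)
    (hγ : IsAdmissible (Ioi (0 : ℝ)) μ ν γ) :
    ∫⁻ τ in Ioi 0, ENNReal.ofReal (max (upperQuantile μ τ - upperQuantile ν τ) 0 ^ p) ≤
      ∫⁻ z, ENNReal.ofReal (max (z.1 - z.2) 0 ^ p) ∂γ := by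
  have := hγ.sFinite_restrict hp hμ hν
  set D : Set (ℝ × ℝ) := {z | 0 < z.1 ∨ 0 < z.2}
  -- An arbitrary mass at the corner could break s-finiteness; discarding it only lowers the right
  -- side.
  refine le_trans ?_ (lintegral_mono' (Measure.restrict_le_self (s := D)) le_rfl)
  rw [lintegral_posPart_rpow_eq hp _ (measurable_upperQuantile hp hμ)
      (measurable_upperQuantile hp hν) (Filter.Eventually.of_forall (upperQuantile_nonneg ν)),
    lintegral_posPart_rpow_eq hp (γ.restrict D) measurable_fst measurable_snd
      (ae_restrict_of_ae (hγ.ae_nonneg.mono fun z hz => hz.2)), Measure.prod_restrict]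
  refine setLIntegral_mono' (measurableSet_Ioi.prod measurableSet_Ioi) fun q hq => ?_
  have hq1 : 0 < q.1 := hq.1
  let U : Set ℝ := {x | q.1 ≤ x ∧ q.2 ≤ p * (x - q.1) ^ (p - 1)}
  -- Here `p ≥ 1` makes `x ↦ p * (x - q.1) ^ (p - 1)` nondecreasing on `[q.1, ∞)`.
  have hU : IsUpperSet U := by
    intro x y hxy hx
    refine ⟨hx.1.trans hxy, hx.2.trans ?_⟩
    have h1 := sub_nonneg.2 hx.1
    have h2 : 0 ≤ p - 1 := by linarith
    gcongr
  refine (hγ.volume_upperQuantile_le hp hμ hν hU (fun x hx => hq1.trans_le hx.1) hq1).trans_eq ?_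
  have hm : MeasurableSet {z : ℝ × ℝ | z.2 < q.1 ∧ z.1 ∈ U} :=
    (measurableSet_lt measurable_snd measurable_const).inter
      (measurable_fst hU.ordConnected.measurableSet)
  change _ = γ.restrict D {z : ℝ × ℝ | z.2 < q.1 ∧ z.1 ∈ U}
  rw [Measure.restrict_apply hm, inter_eq_left.2]
  exact fun z hz => Or.inl (hq1.trans_le hz.2.1)

theorem ofReal_abs_sub_rpow (hp : 1 ≤ p) (x y : ℝ) :
    ENNReal.ofReal (|x - y| ^ p) =
      ENNReal.ofReal (max (x - y) 0 ^ p) + ENNReal.ofReal (max (y - x) 0 ^ p) := by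
  have hp0 : p ≠ 0 := by linarith
  rcases le_total x y with h | h
  · rw [max_eq_right (by linarith : x - y ≤ 0), max_eq_left (by linarith : 0 ≤ y - x),
      abs_of_nonpos (by linarith), Real.zero_rpow hp0]
    simp
  · rw [max_eq_left (by linarith : 0 ≤ x - y), max_eq_right (by linarith : y - x ≤ 0),
      abs_of_nonneg (by linarith), Real.zero_rpow hp0]
    simp

theorem edist_rpow_eq (hp : 1 ≤ p) (x y : ℝ) : edist x y ^ p = ENNReal.ofReal (|x - y| ^ p) := by
  rw [edist_dist, Real.dist_eq, ENNReal.ofReal_rpow_of_nonneg (abs_nonneg _) (by linarith)]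

theorem IsAdmissible.lintegral_upperQuantile_le (hp : 1 ≤ p)
    (hμ : IsPersistenceMeasure (Ioi (0 : ℝ)) p μ) (hν : IsPersistenceMeasure (Ioi (0 : ℝ)) p ν)
    (hγ : IsAdmissible (Ioi (0 : ℝ)) μ ν γ) :
    ∫⁻ t in Ioi 0, ENNReal.ofReal (|upperQuantile μ t - upperQuantile ν t| ^ p) ≤
      ∫⁻ z, ENNReal.ofReal (|z.1 - z.2| ^ p) ∂γ := by
  have hmμ := measurable_upperQuantile hp hμ
  have hmν := measurable_upperQuantile hp hν
  simp_rw [ofReal_abs_sub_rpow hp]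
  rw [lintegral_add_left (by fun_prop), lintegral_add_left (by fun_prop)]
  refine add_le_add (hγ.lintegral_posPart_le hp hμ hν)
    ((hγ.swap.lintegral_posPart_le hp hν hμ).trans_eq ?_)
  rw [lintegral_map (by fun_prop) measurable_swap]
  rfl

end Plans

end FigalliGigli

theorem mainTheorem4 (p : ℝ) (hp : 1 ≤ p) (μ ν : Measure ℝ)
    (hμ : FigalliGigli.IsPersistenceMeasure (Ioi (0 : ℝ)) p μ)
    (hν : FigalliGigli.IsPersistenceMeasure (Ioi (0 : ℝ)) p ν) :
    FigalliGigli.FG (Ioi (0 : ℝ)) p μ ν ^ p =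
      ∫⁻ t in Ioi (0 : ℝ), ENNReal.ofReal
        (|FigalliGigli.upperQuantile μ t - FigalliGigli.upperQuantile ν t| ^ p) := by
  have hp0 : p ≠ 0 := by linarith
  have hcost : ∀ γ : Measure (ℝ × ℝ), FigalliGigli.IsAdmissible (Ioi (0 : ℝ)) μ ν γ →
      ∫⁻ z in closure (Ioi (0 : ℝ)) ×ˢ closure (Ioi (0 : ℝ)), edist z.1 z.2 ^ p ∂γ =
        ∫⁻ z, ENNReal.ofReal (|z.1 - z.2| ^ p) ∂γ := by
    intro γ hγ
    rw [Measure.restrict_eq_self_of_ae_mem (measure_eq_zero_iff_ae_notMem.1 hγ.compl_eq_zero |>.mono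
      fun z hz => not_not.1 hz)]
    exact lintegral_congr fun z => FigalliGigli.edist_rpow_eq hp z.1 z.2
  rw [FigalliGigli.FG, ← ENNReal.rpow_mul, one_div_mul_cancel hp0, ENNReal.rpow_one]
  refine le_antisymm ?_ (le_iInf₂ fun γ hγ => ?_)
  · have hadm := FigalliGigli.isAdmissible_quantilePlan hp hμ hν
    refine (iInf₂_le _ hadm).trans_eq ?_
    rw [hcost _ hadm, FigalliGigli.quantilePlan,
      lintegral_map (by fun_prop) ((FigalliGigli.measurable_upperQuantile hp hμ).prodMk
        (FigalliGigli.measurable_upperQuantile hp hν))]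
  · rw [hcost γ hγ]
    exact hγ.lintegral_upperQuantile_le hp hμ hν
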